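/- Let $N,d,m$ be positive integers, $L>0$, $L_g\ge 0$, and consider $$\min_{x}\; h(x):=\sum_{i=1}^N f_i(x_i)+\sum_{j=1}^m g_j(x),\qquad x=(x_1,\dots,x_N)\in(\mathbb R^d)^N=\mathbb R^{Nd},$$ where every $f_i:\mathbb R^d\to\mathbb R$ is convex and differentiable with $L$-Lipschitz gradient, and every $g_j:\mathbb R^{Nd}\to\mathbb R$ is convex and $L_g$-Lipschitz (with respect to the Euclidean norm) and depends only on the blocks $x_i$ with $i\in S_j\subseteq\{1,\dots,N\}$. Assume that the set $X^*$ of minimizers of $h$ is nonempty, and let $h^*=\min h$. Given a deterministic starting point $x_0$, let $D_*=\operatorname{dist}(x_0,X^*)$. No bound on the gradients $\nabla f_i$ is assumed. BlockProx with constant step size $\tau>0$ generates, for $t=0,1,2,\dots$, $$y_t=x_t-\tau\bigl(\nabla f_1(x_t^{(1)}),\dots,\nabla f_N(x_t^{(N)})\bigr),\qquad x_{t+1}^{(i)}=\begin{cases}\bigl[\operatorname{prox}_{m\tau g_{j_{i,t}}}(y_t)\bigr]_i,& i\in S_{j_{i,t}},\\ y_t^{(i)},& i\notin S_{j_{i,t}},\end{cases}$$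 where $x^{(i)}$ denotes the $i$-th block of $x$, $\operatorname{prox}_{\varphi}(y)=\operatorname{argmin}_z\{\varphi(z)+\tfrac12\|y-z\|^2\}$, each $j_{i,t}$ is uniformly distributed on $\{1,\dots,m\}$, and the random vectors $(j_{1,t},\dots,j_{N,t})$, $t=0,1,2,\dots$, are independent (the joint law of the selections of the nodes within one iteration is arbitrary; in particular they may be independent). Then, for every $T\ge 1$, running BlockProx with the step size $\tau=\dfrac{1}{3L\sqrt T}$, the random variable $h(x_T)$ is integrable and $$\mathbb E\,[h(x_T)-h^*]\;\le\; C\,\frac{\ln(T+1)}{\sqrt T},$$ where the constant $C$ depends only on $m$, $L$, $L_g$ and (an upper bound on) $D_*$; in particular it does not depend on $T$, $N$ or $d$. -/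

import Mathlib

open MeasureTheory ProbabilityTheory
open scoped NNReal ENNReal

/-- The space `ℝ^{Nd}` of vectors `x = (x_1, …, x_N)` with blocks `x_i ∈ ℝ^d`, with its
Euclidean norm. -/
abbrev BlockSpace (N d : ℕ) : Type :=
  PiLp 2 (fun _ : Fin N => EuclideanSpace ℝ (Fin d))

/-- The proximal operator `prox_φ(x) = argmin_z { φ(z) + ½ ‖x - z‖² }`. For convex Lipschitz `φ`
on a Euclidean space, the minimizer exists and is unique. -/
noncomputable def prox {X : Type*} [NormedAddCommGroup X] (φ : X → ℝ) (x : X) : X :=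
  @Classical.epsilon X ⟨x⟩
    (fun p => IsMinOn (fun z => φ z + (1 / 2) * ‖x - z‖ ^ 2) Set.univ p)

/-- The objective `h(x) = ∑ i, f_i(x_i) + ∑ j, g_j(x)`. -/
noncomputable def blockObjective {N d m : ℕ} (f : Fin N → EuclideanSpace ℝ (Fin d) → ℝ)
    (g : Fin m → BlockSpace N d → ℝ) (x : BlockSpace N d) : ℝ :=
  ∑ i, f i (x i) + ∑ j, g j x

/-- The set of minimizers of `h`. -/
def minimizers {X : Type*} (h : X → ℝ) : Set X :=
  {x | IsMinOn h Set.univ x}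

/-- `φ` depends only on the blocks of `x` with index in `S`. -/
def DependsOnlyOnBlocks {N d : ℕ} (φ : BlockSpace N d → ℝ) (S : Finset (Fin N)) : Prop :=
  ∀ x y : BlockSpace N d, (∀ i ∈ S, x i = y i) → φ x = φ y

/-- The gradient step `y = x - τ (∇f_1(x_1), …, ∇f_N(x_N))`. -/
noncomputable def blockGradStep {N d : ℕ} (f : Fin N → EuclideanSpace ℝ (Fin d) → ℝ) (τ : ℝ)
    (x : BlockSpace N d) : BlockSpace N d :=
  WithLp.toLp 2 (fun i => x i - τ • gradient (f i) (x i))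

/-- One iteration of BlockProx from `x`, where node `i` has selected the term `g_{J i}`:
block `i` of the result is block `i` of `prox_{mτ g_{J i}}(y)` if `i ∈ S_{J i}`,
and block `i` of `y` otherwise. -/
noncomputable def blockProxStep {N d m : ℕ} (f : Fin N → EuclideanSpace ℝ (Fin d) → ℝ)
    (g : Fin m → BlockSpace N d → ℝ) (S : Fin m → Finset (Fin N)) (τ : ℝ)
    (J : Fin N → Fin m) (x : BlockSpace N d) : BlockSpace N d :=
  WithLp.toLp 2 (fun i =>
    if i ∈ S (J i) then
      prox (fun z => (m : ℝ) * τ * g (J i) z) (blockGradStep f τ x) i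
    else blockGradStep f τ x i)

/-- The iterates `x_0, x_1, …` of BlockProx with constant step `τ`, where `J t i` is the index
selected by node `i` at iteration `t`. -/
noncomputable def blockProxIter {N d m : ℕ} (f : Fin N → EuclideanSpace ℝ (Fin d) → ℝ)
    (g : Fin m → BlockSpace N d → ℝ) (S : Fin m → Finset (Fin N)) (τ : ℝ)
    (x₀ : BlockSpace N d) (J : ℕ → Fin N → Fin m) : ℕ → BlockSpace N d
  | 0 => x₀
  | t + 1 => blockProxStep f g S τ (J t) (blockProxIter f g S τ x₀ J t)

/-!
Last-iterate convergence of BlockProx at the rate `log (T + 1) / √T`, with no bound on the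
gradients `∇f_i`.

*One step.* Write `y_t` for the point after the gradient step from `x_t`. A proximal operator of
`g_j` moves only the blocks in `S_j`, so every block of `x_{t+1}` is the corresponding block of some
`p_j = prox_{mτ g_j}(y_t)` (`blockProxStep_apply`). The squared distance to a point `z` is a sum
over blocks, hence only the uniform marginals of the selections matter for its expectation: for `z`
determined by the selections before time `t`, the conditional mean of `‖x_{t+1} - z‖²` is the
average over `j` of `‖p_j - z‖²`. The proximal inequality and the gradient inequality then give
`E ‖x_{t+1} - z‖² ≤ E ‖x_t - z‖² - 2τ E (h(y_t) - h(z)) + τ² M²`, with `M = m² L_g`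
(`BlockProxSetting.integral_norm_step_le`). Because `h` is evaluated at `y_t`, the decrease of the
smooth part along the gradient step absorbs the term `τ² ‖∇f(x_t)‖²`.

*Last term.* Put `a_t = E h(y_t) - h*`. Taking for `z` a minimizer bounds the average of the `a_t`.
Taking `z = y_s` and starting at `x_{s+1}`, which lies within `τ M` of `y_s`, bounds the sum of
`a_t - a_s` over `s < t ≤ n` by `(n - s + 1) τ M² / 2`, again without gradient terms
(`BlockProxSetting.sum_integral_sub_le`). An averaging argument over suffixes turns these into a
bound on the last term, at the cost of a harmonic sum, which is the logarithm
(`last_le_average_add_log`).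

*Back to the iterates.* It remains to bound `h(x_T) - h(y_{T-1})`. At a minimizer `x*` the gradient
of the smooth part is at most `m L_g` in norm, because there it is balanced by the nonsmooth part.
So the gradient at `x_T` is at most `m L_g + L ‖x_T - x*‖`, whose expectation is controlled by the
one-step inequality with `z = x*` (`BlockProxSetting.integral_objective_sub_gradStep_le`).
-/

/-! ### Convex functions with Lipschitz gradient -/

section Convex

variable {X : Type*} [NormedAddCommGroup X] [InnerProductSpace ℝ X]

/-- Comparison of first-order terms: an inequality between linear functions of `s` that holds up to
a multiple of `s ^ 2` for small `s > 0` holds between the slopes. -/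
lemma le_of_forall_small_mul_le {a b c : ℝ}
    (h : ∀ s : ℝ, 0 < s → s < 1 → s * a ≤ s * b + s ^ 2 * c) : a ≤ b := by
  by_contra hab
  push Not at hab
  set s : ℝ := min (1 / 2) ((a - b) / (2 * (|c| + 1))) with hs
  have hc : 0 < 2 * (|c| + 1) := by positivity
  have hs0 : 0 < s := lt_min (by norm_num) (div_pos (by linarith) hc)
  have hs1 : s < 1 := lt_of_le_of_lt (min_le_left _ _) (by norm_num)
  have h1 : s * (2 * (|c| + 1)) ≤ a - b := (le_div_iff₀ hc).1 (min_le_right _ _)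
  have h2 := h s hs0 hs1
  have h3 : a - b ≤ s * c := by
    have : s * (a - b) ≤ s * (s * c) := by nlinarith
    exact le_of_mul_le_mul_left this hs0
  nlinarith [le_abs_self c, abs_nonneg c]

lemma ConvexOn.sub_le_inner_gradient [CompleteSpace X] {f : X → ℝ}
    (hf : ConvexOn ℝ Set.univ f) {x : X} (hx : DifferentiableAt ℝ f x) (y : X) :
    f x - f y ≤ inner ℝ (gradient f x) (x - y) := by
  have hd : HasDerivAt (fun s : ℝ => f (x + s • (y - x))) (inner ℝ (gradient f x) (y - x)) 0 := by
    have h1 : HasDerivAt (fun s : ℝ => x + s • (y - x)) (y - x) 0 := by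
      simpa using ((hasDerivAt_id (0 : ℝ)).smul_const (y - x)).const_add x
    have h2 : HasFDerivAt f (InnerProductSpace.toDual ℝ X (gradient f x)) (x + (0 : ℝ) • (y - x)) := by
      simpa using hx.hasGradientAt.hasFDerivAt
    exact h2.comp_hasDerivAt (0 : ℝ) h1
  have hconv : ConvexOn ℝ Set.univ (fun s : ℝ => f (x + s • (y - x))) := by
    have := hf.comp_affineMap (AffineMap.lineMap x y : ℝ →ᵃ[ℝ] X)
    simp only [Set.preimage_univ] at this
    refine this.congr fun s _ => ?_
    simp [AffineMap.lineMap_apply, add_comm]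
  have h := hconv.le_slope_of_hasDerivAt (Set.mem_univ 0) (Set.mem_univ 1) one_pos hd
  simp only [slope_def_field, one_smul, zero_smul, add_zero, sub_zero, div_one,
    add_sub_cancel] at h
  rw [← neg_sub y x, inner_neg_right]
  linarith

/-- A gradient step of length `s` decreases a convex function with `L`-Lipschitz gradient map `G`
by at least `s (1 - L s) ‖G x‖ ^ 2`. Convexity alone, used at the endpoint, yields this weak form
of the descent lemma. -/
lemma sub_gradient_step_le {F : X → ℝ} {G : X → X} {L : ℝ}
    (hF : ∀ x y, F x - F y ≤ inner ℝ (G x) (x - y))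
    (hG : ∀ x y, ‖G x - G y‖ ≤ L * ‖x - y‖) {s : ℝ} (hs : 0 ≤ s) (x : X) :
    F (x - s • G x) ≤ F x - s * (1 - L * s) * ‖G x‖ ^ 2 := by
  have h1 := hF (x - s • G x) x
  have h2 : inner ℝ (G (x - s • G x)) (x - s • G x - x)
      = -s * ‖G x‖ ^ 2 + -s * inner ℝ (G (x - s • G x) - G x) (G x) := by
    rw [show x - s • G x - x = (-s) • G x by module, inner_smul_right, inner_sub_left,
      real_inner_self_eq_norm_sq]
    ring
  have h3 : -inner ℝ (G (x - s • G x) - G x) (G x) ≤ L * s * ‖G x‖ ^ 2 := by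
    have h4 := hG (x - s • G x) x
    rw [show x - s • G x - x = (-s) • G x by module, norm_smul, norm_neg, Real.norm_of_nonneg hs]
      at h4
    have h5 := (abs_le.1 (abs_real_inner_le_norm (G (x - s • G x) - G x) (G x))).1
    nlinarith [mul_le_mul_of_nonneg_right h4 (norm_nonneg (G x))]
  nlinarith [mul_le_mul_of_nonneg_left h3 hs]

/-- The progress of a gradient step `y = x - τ • G x` towards `z`, with the objective evaluated at
the new point `y`, so that no bound on the gradient is involved. -/
lemma norm_gradient_step_sub_sq_le {F : X → ℝ} {G : X → X} {L τ : ℝ}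
    (hF : ∀ x y, F x - F y ≤ inner ℝ (G x) (x - y))
    (hG : ∀ x y, ‖G x - G y‖ ≤ L * ‖x - y‖) (hτ : 0 ≤ τ) (hLτ : L * τ ≤ 1 / 2) (x z : X) :
    ‖x - τ • G x - z‖ ^ 2 ≤ ‖x - z‖ ^ 2 - 2 * τ * (F (x - τ • G x) - F z) := by
  have h1 := sub_gradient_step_le hF hG hτ x
  have h2 := hF x z
  have h3 : ‖x - τ • G x - z‖ ^ 2
      = ‖x - z‖ ^ 2 - 2 * τ * inner ℝ (G x) (x - z) + τ ^ 2 * ‖G x‖ ^ 2 := by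
    rw [show x - τ • G x - z = (x - z) - τ • G x by abel, norm_sub_sq_real, inner_smul_right,
      norm_smul, Real.norm_of_nonneg hτ, real_inner_comm]
    ring
  have h4 : 0 ≤ τ ^ 2 * ‖G x‖ ^ 2 * (1 / 2 - L * τ) :=
    mul_nonneg (by positivity) (by linarith)
  rw [h3]
  nlinarith [mul_le_mul_of_nonneg_left h1 hτ, mul_le_mul_of_nonneg_left h2 hτ]

/-- At a minimizer of the sum of a smooth and a `K`-Lipschitz function, the gradient of the smooth
part has norm at most `K`. -/
lemma norm_gradient_le_of_isMinOn {F g : X → ℝ} {G : X → X} {L K : ℝ}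
    (hF : ∀ x y, F x - F y ≤ inner ℝ (G x) (x - y))
    (hG : ∀ x y, ‖G x - G y‖ ≤ L * ‖x - y‖)
    (hg : ∀ x y, g x - g y ≤ K * ‖x - y‖) (hK : 0 ≤ K) {x : X}
    (hx : IsMinOn (fun z => F z + g z) Set.univ x) : ‖G x‖ ≤ K := by
  have h : ‖G x‖ ^ 2 ≤ K * ‖G x‖ := by
    refine le_of_forall_small_mul_le (c := L * ‖G x‖ ^ 2) fun s hs _ => ?_
    have h1 : F x + g x ≤ F (x - s • G x) + g (x - s • G x) := hx (Set.mem_univ _)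
    have h2 := sub_gradient_step_le hF hG hs.le x
    have h3 := hg (x - s • G x) x
    rw [show x - s • G x - x = (-s) • G x by module, norm_smul, norm_neg,
      Real.norm_of_nonneg hs.le] at h3
    nlinarith
  rcases (norm_nonneg (G x)).eq_or_lt with h0 | h0
  · rwa [← h0]
  · rw [sq] at h
    exact le_of_mul_le_mul_right h h0

end Convex

/-! ### Proximal operators -/

section Prox

variable {X : Type*} [NormedAddCommGroup X] [ProperSpace X] {φ : X → ℝ} {K : ℝ}

lemma isMinOn_prox (hK : 0 ≤ K) (hφ : ∀ x y, φ x - φ y ≤ K * ‖x - y‖) (hc : Continuous φ) (x : X) :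
    IsMinOn (fun z => φ z + (1 / 2) * ‖x - z‖ ^ 2) Set.univ (prox φ x) := by
  refine @Classical.epsilon_spec X (fun p => IsMinOn (fun z => φ z + (1 / 2) * ‖x - z‖ ^ 2)
    Set.univ p) ?_
  have hcont : Continuous (fun z => φ z + (1 / 2) * ‖x - z‖ ^ 2) := by fun_prop
  obtain ⟨p, hp⟩ := hcont.exists_forall_le_of_isBounded x (by
    refine (Metric.isBounded_closedBall (x := x) (r := 2 * K)).subset fun z hz => ?_
    replace hz : φ z + (1 / 2) * ‖x - z‖ ^ 2 ≤ φ x + (1 / 2) * ‖x - x‖ ^ 2 := hz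
    simp only [sub_self, norm_zero] at hz
    rw [Metric.mem_closedBall, dist_comm, dist_eq_norm]
    have h1 := hφ x z
    rcases (norm_nonneg (x - z)).eq_or_lt with h0 | h0
    · rw [← h0]
      positivity
    · refine le_of_mul_le_mul_right (?_ : ‖x - z‖ * ‖x - z‖ ≤ 2 * K * ‖x - z‖) h0
      nlinarith)
  exact ⟨p, fun z _ => hp z⟩

variable [InnerProductSpace ℝ X]

/-- The optimality condition of the proximal point: `x - prox φ x` is a subgradient of `φ` at
`prox φ x`. -/
lemma inner_sub_prox_le (hconv : ConvexOn ℝ Set.univ φ) (hK : 0 ≤ K)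
    (hφ : ∀ x y, φ x - φ y ≤ K * ‖x - y‖) (hc : Continuous φ) (x z : X) :
    inner ℝ (x - prox φ x) (z - prox φ x) ≤ φ z - φ (prox φ x) := by
  set p := prox φ x with hp
  refine le_of_forall_small_mul_le (c := (1 / 2) * ‖z - p‖ ^ 2) fun s hs hs1 => ?_
  have h1 : φ p + (1 / 2) * ‖x - p‖ ^ 2
      ≤ φ ((1 - s) • p + s • z) + (1 / 2) * ‖x - ((1 - s) • p + s • z)‖ ^ 2 :=
    isMinOn_prox hK hφ hc x (Set.mem_univ _)
  have h2 : φ ((1 - s) • p + s • z) ≤ (1 - s) * φ p + s * φ z :=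
    hconv.2 (Set.mem_univ _) (Set.mem_univ _) (by linarith) hs.le (by ring)
  have h3 : ‖x - ((1 - s) • p + s • z)‖ ^ 2
      = ‖x - p‖ ^ 2 - 2 * (s * inner ℝ (x - p) (z - p)) + s ^ 2 * ‖z - p‖ ^ 2 := by
    rw [show x - ((1 - s) • p + s • z) = (x - p) - s • (z - p) by module, norm_sub_sq_real,
      inner_smul_right, norm_smul, mul_pow, Real.norm_eq_abs, sq_abs]
  rw [h3] at h1
  nlinarith

lemma norm_sub_prox_le (hconv : ConvexOn ℝ Set.univ φ) (hK : 0 ≤ K)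
    (hφ : ∀ x y, φ x - φ y ≤ K * ‖x - y‖) (hc : Continuous φ) (x : X) :
    ‖x - prox φ x‖ ≤ K := by
  have h1 := inner_sub_prox_le hconv hK hφ hc x x
  rw [real_inner_self_eq_norm_sq] at h1
  have h2 := hφ x (prox φ x)
  rcases (norm_nonneg (x - prox φ x)).eq_or_lt with h0 | h0
  · rwa [← h0]
  · refine le_of_mul_le_mul_right (?_ : ‖x - prox φ x‖ * ‖x - prox φ x‖ ≤ _) h0
    nlinarith

/-- The progress of a proximal step towards `z`, with `φ` evaluated at the old point. -/
lemma norm_prox_sub_sq_le (hconv : ConvexOn ℝ Set.univ φ) (hK : 0 ≤ K)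
    (hφ : ∀ x y, φ x - φ y ≤ K * ‖x - y‖) (hc : Continuous φ) (x z : X) :
    ‖prox φ x - z‖ ^ 2 ≤ ‖x - z‖ ^ 2 - 2 * (φ x - φ z) + K ^ 2 := by
  have h1 := inner_sub_prox_le hconv hK hφ hc x z
  have h2 := hφ x (prox φ x)
  have h3 : ‖x - z‖ ^ 2 = ‖x - prox φ x‖ ^ 2 - 2 * inner ℝ (x - prox φ x) (z - prox φ x)
      + ‖prox φ x - z‖ ^ 2 := by
    rw [show x - z = (x - prox φ x) - (z - prox φ x) by abel, norm_sub_sq_real,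
      norm_sub_rev z]
  nlinarith [sq_nonneg (‖x - prox φ x‖ - K)]

end Prox

/-! ### The block structure -/

section Block

variable {N d m : ℕ} {f : Fin N → EuclideanSpace ℝ (Fin d) → ℝ} {g : Fin m → BlockSpace N d → ℝ}
  {S : Fin m → Finset (Fin N)} {τ : ℝ} {L Lg : ℝ≥0}

/-- The gradient of `x ↦ ∑ i, f_i(x_i)`, i.e. the vector `(∇f_1(x_1), …, ∇f_N(x_N))`. -/
noncomputable def blockGradient (f : Fin N → EuclideanSpace ℝ (Fin d) → ℝ) (x : BlockSpace N d) :
    BlockSpace N d :=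
  WithLp.toLp 2 (fun i => gradient (f i) (x i))

lemma sum_sub_sum_le_inner_blockGradient (hf : ∀ i, ConvexOn ℝ Set.univ (f i))
    (hd : ∀ i, Differentiable ℝ (f i)) (x y : BlockSpace N d) :
    ∑ i, f i (x i) - ∑ i, f i (y i) ≤ inner ℝ (blockGradient f x) (x - y) := by
  rw [PiLp.inner_apply, ← Finset.sum_sub_distrib]
  exact Finset.sum_le_sum fun i _ => (hf i).sub_le_inner_gradient (hd i (x i)) (y i)

lemma norm_blockGradient_sub_le (hL : ∀ i, LipschitzWith L (gradient (f i)))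
    (x y : BlockSpace N d) : ‖blockGradient f x - blockGradient f y‖ ≤ L * ‖x - y‖ := by
  refine le_of_sq_le_sq ?_ (by positivity)
  rw [mul_pow, PiLp.norm_sq_eq_of_L2, PiLp.norm_sq_eq_of_L2, Finset.mul_sum]
  refine Finset.sum_le_sum fun i _ => ?_
  rw [← mul_pow]
  have := (hL i).dist_le_mul (x i) (y i)
  rw [dist_eq_norm, dist_eq_norm] at this
  exact pow_le_pow_left₀ (norm_nonneg _) this 2

lemma sub_le_of_lipschitzWith {X : Type*} [SeminormedAddCommGroup X] {φ : X → ℝ} {K : ℝ≥0}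
    (h : LipschitzWith K φ) (x y : X) : φ x - φ y ≤ K * ‖x - y‖ := by
  have := h.dist_le_mul x y
  rw [Real.dist_eq, dist_eq_norm] at this
  exact (le_abs_self _).trans this

lemma sum_sub_sum_le_of_lipschitzWith (hg : ∀ j, LipschitzWith Lg (g j)) (x y : BlockSpace N d) :
    ∑ j, g j x - ∑ j, g j y ≤ (m * Lg) * ‖x - y‖ := by
  rw [← Finset.sum_sub_distrib]
  refine (Finset.sum_le_sum fun j _ => sub_le_of_lipschitzWith (hg j) x y).trans_eq ?_
  simp [mul_assoc]

/-- The proximal operator of a function of the blocks in `S` leaves the other blocks unchanged. -/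
lemma prox_apply_eq_of_notMem {φ : BlockSpace N d → ℝ} {K : ℝ} {S : Finset (Fin N)}
    (hconv : ConvexOn ℝ Set.univ φ) (hK : 0 ≤ K) (hφ : ∀ x y, φ x - φ y ≤ K * ‖x - y‖)
    (hc : Continuous φ) (hS : DependsOnlyOnBlocks φ S) (x : BlockSpace N d) {i : Fin N}
    (hi : i ∉ S) : prox φ x i = x i := by
  set p := prox φ x with hp
  -- Compare with the point obtained from `p` by restoring block `i` of `x`.
  have h1 := inner_sub_prox_le hconv hK hφ hc x (WithLp.toLp 2 (Function.update p.ofLp i (x i)))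
  rw [← hp, hS (WithLp.toLp 2 (Function.update p.ofLp i (x i))) p (fun k hk => by
    have : k ≠ i := fun h => hi (h ▸ hk)
    simp [this]), sub_self, PiLp.inner_apply, Finset.sum_eq_single i (fun k _ hk => by simp [hk])
    (by simp)] at h1
  simp only [PiLp.sub_apply, Function.update_self, real_inner_self_eq_norm_sq] at h1
  have h2 : ‖x i - p i‖ = 0 := by
    have := sq_nonneg ‖x i - p i‖
    exact pow_eq_zero_iff two_ne_zero |>.1 (le_antisymm h1 this)
  exact (sub_eq_zero.1 (norm_eq_zero.1 h2)).symm

/-- The hypotheses on `g j`, transferred to the function `m τ g_j` whose proximal operator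
BlockProx uses. -/
lemma scaled_convexOn (hτ : 0 ≤ τ) (hg : ∀ j, ConvexOn ℝ Set.univ (g j)) (j : Fin m) :
    ConvexOn ℝ Set.univ (fun z => (m : ℝ) * τ * g j z) :=
  (hg j).smul (by positivity : 0 ≤ (m : ℝ) * τ)

lemma scaled_sub_le (hτ : 0 ≤ τ) (hg : ∀ j, LipschitzWith Lg (g j)) (j : Fin m)
    (x y : BlockSpace N d) :
    (m : ℝ) * τ * g j x - (m : ℝ) * τ * g j y ≤ m * τ * Lg * ‖x - y‖ := by
  rw [← mul_sub, mul_assoc _ (Lg : ℝ)]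
  exact mul_le_mul_of_nonneg_left (sub_le_of_lipschitzWith (hg j) x y) (by positivity)

lemma scaled_continuous (hg : ∀ j, LipschitzWith Lg (g j)) (j : Fin m) :
    Continuous (fun z => (m : ℝ) * τ * g j z) :=
  continuous_const.mul (hg j).continuous

/-- Since proximal operators do not move the blocks on which the function does not depend, the case
distinction in a BlockProx step is immaterial. -/
lemma blockProxStep_apply (hτ : 0 ≤ τ) (hgc : ∀ j, ConvexOn ℝ Set.univ (g j))
    (hg : ∀ j, LipschitzWith Lg (g j)) (hS : ∀ j, DependsOnlyOnBlocks (g j) (S j))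
    (v : Fin N → Fin m) (x : BlockSpace N d) (i : Fin N) :
    blockProxStep f g S τ v x i
      = prox (fun z => (m : ℝ) * τ * g (v i) z) (blockGradStep f τ x) i := by
  by_cases hi : i ∈ S (v i)
  · simp [blockProxStep, hi]
  · rw [prox_apply_eq_of_notMem (scaled_convexOn hτ hgc (v i)) (by positivity)
      (scaled_sub_le hτ hg (v i)) (scaled_continuous hg (v i))
      (fun x y h => by simp only [hS (v i) x y h]) _ hi]
    simp [blockProxStep, hi]

/-- Whatever the nodes select, a step moves away from `y` by at most `τ m² L_g`. -/
lemma norm_blockProxStep_sub_le (hτ : 0 ≤ τ) (hgc : ∀ j, ConvexOn ℝ Set.univ (g j))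
    (hg : ∀ j, LipschitzWith Lg (g j)) (hS : ∀ j, DependsOnlyOnBlocks (g j) (S j))
    (hm : 1 ≤ m) (v : Fin N → Fin m) (x : BlockSpace N d) :
    ‖blockProxStep f g S τ v x - blockGradStep f τ x‖ ≤ τ * (m ^ 2 * Lg) := by
  refine le_of_sq_le_sq ?_ (by positivity)
  set y := blockGradStep f τ x with hy
  set p : Fin m → BlockSpace N d := fun j => prox (fun z => (m : ℝ) * τ * g j z) y with hp
  have hm' : (1 : ℝ) ≤ m := by exact_mod_cast hm
  calc ‖blockProxStep f g S τ v x - y‖ ^ 2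
      = ∑ i, ‖p (v i) i - y i‖ ^ 2 := by
        rw [PiLp.norm_sq_eq_of_L2]
        refine Finset.sum_congr rfl fun i _ => ?_
        rw [PiLp.sub_apply, blockProxStep_apply hτ hgc hg hS]
    _ ≤ ∑ i, ∑ j, ‖p j i - y i‖ ^ 2 := Finset.sum_le_sum fun i _ =>
        Finset.single_le_sum (f := fun j => ‖p j i - y i‖ ^ 2) (fun j _ => by positivity)
          (Finset.mem_univ (v i))
    _ = ∑ j, ‖y - p j‖ ^ 2 := by
        rw [Finset.sum_comm]
        refine Finset.sum_congr rfl fun j _ => ?_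
        rw [norm_sub_rev, PiLp.norm_sq_eq_of_L2]
        rfl
    _ ≤ ∑ j : Fin m, (m * τ * Lg) ^ 2 := Finset.sum_le_sum fun j _ =>
        pow_le_pow_left₀ (norm_nonneg _) (norm_sub_prox_le (scaled_convexOn hτ hgc j)
          (by positivity) (scaled_sub_le hτ hg j) (scaled_continuous hg j) y) 2
    _ = m * (m * τ * Lg) ^ 2 := by simp
    _ ≤ (m * m) * (m * τ * Lg) ^ 2 := by
        refine mul_le_mul_of_nonneg_right ?_ (by positivity)
        nlinarith
    _ = _ := by ring

/-- A gradient step followed by the proximal step of a uniformly chosen `g_j`, measured against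
`z`. The factor `m` in `mτ g_j` cancels the probability of choosing `j`, so that the full objective
appears. -/
lemma average_norm_prox_sub_sq_le (hfc : ∀ i, ConvexOn ℝ Set.univ (f i))
    (hfd : ∀ i, Differentiable ℝ (f i)) (hfL : ∀ i, LipschitzWith L (gradient (f i)))
    (hgc : ∀ j, ConvexOn ℝ Set.univ (g j)) (hg : ∀ j, LipschitzWith Lg (g j))
    (hm : 1 ≤ m) (hτ : 0 ≤ τ) (hLτ : L * τ ≤ 1 / 2) (x z : BlockSpace N d) :
    (m : ℝ)⁻¹ * ∑ j, ‖prox (fun z => (m : ℝ) * τ * g j z) (blockGradStep f τ x) - z‖ ^ 2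
      ≤ ‖x - z‖ ^ 2
        - 2 * τ * (blockObjective f g (blockGradStep f τ x) - blockObjective f g z)
        + τ ^ 2 * (m ^ 2 * Lg) ^ 2 := by
  have hm' : (1 : ℝ) ≤ m := by exact_mod_cast hm
  set y := blockGradStep f τ x with hy
  have h1 : ‖y - z‖ ^ 2 ≤ ‖x - z‖ ^ 2 - 2 * τ * (∑ i, f i (y i) - ∑ i, f i (z i)) :=
    norm_gradient_step_sub_sq_le (F := fun x : BlockSpace N d => ∑ i, f i (x i))
      (sum_sub_sum_le_inner_blockGradient hfc hfd) (norm_blockGradient_sub_le hfL) hτ hLτ x z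
  have h2 : ∑ j, ‖prox (fun z => (m : ℝ) * τ * g j z) y - z‖ ^ 2
      ≤ ∑ j : Fin m, (‖y - z‖ ^ 2 - 2 * (m * τ * g j y - m * τ * g j z) + (m * τ * Lg) ^ 2) :=
    Finset.sum_le_sum fun j _ => norm_prox_sub_sq_le (scaled_convexOn hτ hgc j) (by positivity)
      (scaled_sub_le hτ hg j) (scaled_continuous hg j) y z
  have h3 : ∑ j : Fin m, (‖y - z‖ ^ 2 - 2 * (m * τ * g j y - m * τ * g j z) + (m * τ * Lg) ^ 2)
      = m * (‖y - z‖ ^ 2 - 2 * τ * (∑ j, g j y - ∑ j, g j z) + (m * τ * Lg) ^ 2) := by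
    simp only [Finset.sum_add_distrib, Finset.sum_sub_distrib, ← Finset.mul_sum,
      Finset.sum_const, Finset.card_univ, Fintype.card_fin, nsmul_eq_mul]
    ring
  have h4 : (m : ℝ)⁻¹ * ∑ j, ‖prox (fun z => (m : ℝ) * τ * g j z) y - z‖ ^ 2
      ≤ ‖y - z‖ ^ 2 - 2 * τ * (∑ j, g j y - ∑ j, g j z) + (m * τ * Lg) ^ 2 := by
    rw [inv_mul_le_iff₀ (by positivity), ← h3]
    exact h2
  have h5 : (m * τ * (Lg : ℝ)) ^ 2 ≤ τ ^ 2 * (m ^ 2 * Lg) ^ 2 := by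
    rw [← mul_pow]
    refine pow_le_pow_left₀ (by positivity) ?_ 2
    have : (0 : ℝ) ≤ τ * Lg := by positivity
    nlinarith [mul_nonneg this (by nlinarith : (0 : ℝ) ≤ m ^ 2 - m)]
  simp only [blockObjective]
  linarith

lemma blockObjective_sub_le (hfc : ∀ i, ConvexOn ℝ Set.univ (f i))
    (hfd : ∀ i, Differentiable ℝ (f i)) (hfL : ∀ i, LipschitzWith L (gradient (f i)))
    (hg : ∀ j, LipschitzWith Lg (g j)) {z : BlockSpace N d}
    (hz : z ∈ minimizers (blockObjective f g)) (x y : BlockSpace N d) :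
    blockObjective f g x - blockObjective f g y
      ≤ (2 * (m * Lg) + L * ‖x - z‖) * ‖x - y‖ := by
  have h1 := sum_sub_sum_le_inner_blockGradient hfc hfd x y
  have h2 := sum_sub_sum_le_of_lipschitzWith hg x y
  have h3 : ‖blockGradient f z‖ ≤ m * Lg :=
    norm_gradient_le_of_isMinOn (F := fun x : BlockSpace N d => ∑ i, f i (x i))
      (sum_sub_sum_le_inner_blockGradient hfc hfd) (norm_blockGradient_sub_le hfL)
      (sum_sub_sum_le_of_lipschitzWith hg) (by positivity) hz
  have h4 := norm_blockGradient_sub_le hfL x z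
  have h5 : ‖blockGradient f x‖ ≤ m * Lg + L * ‖x - z‖ := by
    have := norm_le_norm_add_norm_sub' (blockGradient f x) (blockGradient f z)
    linarith
  have h6 := real_inner_le_norm (blockGradient f x) (x - y)
  have h7 := mul_le_mul_of_nonneg_right h5 (norm_nonneg (x - y))
  simp only [blockObjective]
  linarith

end Block

/-! ### Expectations over the random selections -/

section Expectation

variable {V Ω : Type*}

lemma exists_eq_comp_restrict_range {Φ : (ℕ → V) → ℝ} {t : ℕ}
    (hΦ : DependsOn Φ (Finset.range t : Set ℕ)) :
    ∃ ψ : (Finset.range t → V) → ℝ, ∀ w, Φ w = ψ (fun s => w s) := by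
  obtain ⟨ψ, hψ⟩ := dependsOn_iff_exists_comp.1 hΦ
  exact ⟨ψ, fun w => congrFun hψ w⟩

variable [Finite V] [MeasurableSpace V] [MeasurableSingletonClass V]
  [MeasurableSpace Ω] {μ : Measure Ω} [IsProbabilityMeasure μ] {J : ℕ → Ω → V}

lemma integrable_of_dependsOn_range (hJ : ∀ t, Measurable (J t)) {Φ : (ℕ → V) → ℝ} {t : ℕ}
    (hΦ : DependsOn Φ (Finset.range t : Set ℕ)) :
    Integrable (fun ω => Φ (fun s => J s ω)) μ := by
  obtain ⟨ψ, hψ⟩ := exists_eq_comp_restrict_range hΦ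
  simp only [hψ]
  have hm : Measurable (fun ω (s : Finset.range t) => J s ω) :=
    measurable_pi_lambda _ fun s => hJ s
  have : IsProbabilityMeasure (μ.map fun ω (s : Finset.range t) => J s ω) :=
    Measure.isProbabilityMeasure_map hm.aemeasurable
  exact (Integrable.of_finite (f := ψ)
    (μ := μ.map fun ω (s : Finset.range t) => J s ω)).comp_measurable hm

/-- If the selection `π (J t)` is uniform, then the expectation of a function of the past and of
this selection is obtained by averaging over the selection first. -/
lemma integral_uniform_selection {m : ℕ} (hJ : ∀ t, Measurable (J t)) (hind : iIndepFun J μ)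
    {t : ℕ} {π : V → Fin m} (hπ : ∀ j, μ {ω | π (J t ω) = j} = (m : ℝ≥0∞)⁻¹)
    {Φ : (ℕ → V) → Fin m → ℝ} (hΦ : ∀ j, DependsOn (fun w => Φ w j) (Finset.range t : Set ℕ)) :
    ∫ ω, Φ (fun s => J s ω) (π (J t ω)) ∂μ
      = ∫ ω, (m : ℝ)⁻¹ * ∑ j, Φ (fun s => J s ω) j ∂μ := by
  have hsplit : ∀ ω, Φ (fun s => J s ω) (π (J t ω))
      = ∑ j, Φ (fun s => J s ω) j * (if π (J t ω) = j then 1 else 0) := by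
    intro ω
    simp
  have hsetm : ∀ j, MeasurableSet {ω | π (J t ω) = j} := fun j =>
    hJ t (Set.toFinite {v : V | π v = j}).measurableSet
  have hprod : ∀ j, ∫ ω, Φ (fun s => J s ω) j * (if π (J t ω) = j then 1 else 0) ∂μ
      = (m : ℝ)⁻¹ * ∫ ω, Φ (fun s => J s ω) j ∂μ := by
    intro j
    obtain ⟨ψ, hψ⟩ : ∃ ψ : (Finset.range t → V) → ℝ, ∀ w, Φ w j = ψ (fun s => w s) :=
      exists_eq_comp_restrict_range (hΦ j)
    have h1 := (hind.indepFun_finset (Finset.range t) {t} (by simp) hJ).integral_fun_comp_mul_comp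
      (f := ψ)
      (g := fun u : ({t} : Finset ℕ) → V => if π (u ⟨t, by simp⟩) = j then (1 : ℝ) else 0)
      (measurable_pi_lambda _ fun s : Finset.range t => hJ s).aemeasurable
      (measurable_pi_lambda _ fun s : ({t} : Finset ℕ) => hJ s).aemeasurable
      (measurable_of_countable _).aestronglyMeasurable
      (measurable_of_countable _).aestronglyMeasurable
    have h2 : ∫ ω, (if π (J t ω) = j then (1 : ℝ) else 0) ∂μ = (m : ℝ)⁻¹ := by
      have : (fun ω => if π (J t ω) = j then (1 : ℝ) else 0)
          = {ω | π (J t ω) = j}.indicator 1 := by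
        ext ω
        simp [Set.indicator_apply]
      rw [this, integral_indicator_one (hsetm j), measureReal_def, hπ j]
      simp
    simp only [hψ]
    rw [h1, h2, mul_comm]
  have hint : ∀ j, Integrable (fun ω => Φ (fun s => J s ω) j) μ := fun j =>
    integrable_of_dependsOn_range hJ (hΦ j)
  simp only [hsplit]
  rw [integral_finsetSum _ fun j _ => ?_, integral_const_mul, integral_finsetSum _ fun j _ => hint j,
    Finset.mul_sum]
  · exact Finset.sum_congr rfl fun j _ => hprod j
  · have : (fun ω => Φ (fun s => J s ω) j * (if π (J t ω) = j then 1 else 0))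
        = {ω | π (J t ω) = j}.indicator (fun ω => Φ (fun s => J s ω) j) := by
      ext ω
      simp [Set.indicator_apply]
    rw [this]
    exact (hint j).indicator (hsetm j)

end Expectation

/-! ### From averages to the last term of a sequence -/

/-- The hypothesis says that `a (n - k)` is at least the average of the `k` terms that follow it, up
to an error `(k + 1) B / k`. Hence passing from the average of the last `k` terms to that of the last `k + 1`
loses at most `2 B / (k + 1)`; summing these harmonic losses bounds the last term. -/
lemma last_le_average_add_log {a : ℕ → ℝ} {n : ℕ} {B : ℝ} (hB : 0 ≤ B)
    (h : ∀ k, 1 ≤ k → k ≤ n →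
      ∑ i ∈ Finset.range k, a (n - i) - k * a (n - k) ≤ (k + 1) * B) (k : ℕ) (hk : k ≤ n) :
    a n ≤ (∑ i ∈ Finset.range (k + 1), a (n - i)) / (k + 1) + 2 * B * Real.log (k + 1) := by
  induction k with
  | zero => simp
  | succ k ih =>
    have h1 := ih (by omega)
    have h2 := h (k + 1) (by omega) hk
    rw [Finset.sum_range_succ]
    set s := ∑ i ∈ Finset.range (k + 1), a (n - i) with hs
    push_cast at h2 ⊢
    have hk0 : (0 : ℝ) < k + 1 := by positivity
    have hlog : 1 / ((k : ℝ) + 1 + 1) ≤ Real.log (k + 1 + 1) - Real.log (k + 1) := by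
      rw [← Real.log_div (by positivity) (by positivity)]
      refine le_trans (le_of_eq ?_) (Real.one_sub_inv_le_log_of_pos (by positivity))
      field_simp
      ring
    have h3 : s / (k + 1) ≤ (s + a (n - (k + 1))) / (k + 1 + 1) + 2 * B * (1 / (k + 1 + 1)) := by
      have h4 : 0 ≤ (s + a (n - (k + 1))) / (k + 1 + 1) + 2 * B * (1 / (k + 1 + 1)) - s / (k + 1) := by
        have : (s + a (n - (k + 1))) / (k + 1 + 1) + 2 * B * (1 / (k + 1 + 1)) - s / (k + 1)
            = ((k + 1) * a (n - (k + 1)) + 2 * B * (k + 1) - s) / ((k + 1 + 1) * (k + 1)) := by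
          field_simp
          ring
        rw [this]
        refine div_nonneg ?_ (by positivity)
        nlinarith [mul_nonneg (Nat.cast_nonneg (α := ℝ) k) hB]
      linarith
    nlinarith [mul_le_mul_of_nonneg_left hlog (by linarith : 0 ≤ 2 * B)]

/-! ### Expected progress of BlockProx -/

section Iteration

variable {N d m : ℕ} {f : Fin N → EuclideanSpace ℝ (Fin d) → ℝ} {g : Fin m → BlockSpace N d → ℝ}
  {S : Fin m → Finset (Fin N)} {τ : ℝ} {L Lg : ℝ≥0}
  {Ω : Type*} [MeasurableSpace Ω] {μ : Measure Ω} [IsProbabilityMeasure μ]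
  {J : ℕ → Ω → Fin N → Fin m}

/-- The assumptions under which BlockProx is analysed: the regularity of the objective, a short
enough step `τ`, and the law of the random selections `J`. -/
structure BlockProxSetting (f : Fin N → EuclideanSpace ℝ (Fin d) → ℝ)
    (g : Fin m → BlockSpace N d → ℝ) (S : Fin m → Finset (Fin N)) (τ : ℝ) (L Lg : ℝ≥0)
    (μ : Measure Ω) (J : ℕ → Ω → Fin N → Fin m) : Prop where
  convex_f : ∀ i, ConvexOn ℝ Set.univ (f i)
  differentiable_f : ∀ i, Differentiable ℝ (f i)
  lipschitz_gradient : ∀ i, LipschitzWith L (gradient (f i))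
  convex_g : ∀ j, ConvexOn ℝ Set.univ (g j)
  lipschitz_g : ∀ j, LipschitzWith Lg (g j)
  dependsOnlyOnBlocks_g : ∀ j, DependsOnlyOnBlocks (g j) (S j)
  one_le_m : 1 ≤ m
  step_pos : 0 < τ
  step_le : L * τ ≤ 1 / 2
  measurable_J : ∀ t, Measurable (J t)
  uniform_J : ∀ t i j, μ {ω | J t ω i = j} = (m : ℝ≥0∞)⁻¹
  indep_J : iIndepFun J μ

/-- The iterate `x_t` is a function of the selections made before time `t`. -/
lemma dependsOn_blockProxIter (f : Fin N → EuclideanSpace ℝ (Fin d) → ℝ)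
    (g : Fin m → BlockSpace N d → ℝ) (S : Fin m → Finset (Fin N)) (τ : ℝ) (x₀ : BlockSpace N d)
    (t : ℕ) : DependsOn (fun w => blockProxIter f g S τ x₀ w t) (Finset.range t : Set ℕ) := by
  induction t with
  | zero => exact fun _ _ _ => rfl
  | succ t ih =>
    intro w w' h
    have h1 := ih fun s hs => h s (by simp at hs ⊢; omega)
    have h2 := h t (by simp)
    simp only [blockProxIter, h2] at h1 ⊢
    rw [h1]

lemma dependsOn_blockGradStep_blockProxIter (f : Fin N → EuclideanSpace ℝ (Fin d) → ℝ)
    (g : Fin m → BlockSpace N d → ℝ) (S : Fin m → Finset (Fin N)) (τ : ℝ) (x₀ : BlockSpace N d)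
    (t : ℕ) : DependsOn (fun w => blockGradStep f τ (blockProxIter f g S τ x₀ w t))
      (Finset.range t : Set ℕ) :=
  fun _ _ h => congrArg (blockGradStep f τ) (dependsOn_blockProxIter f g S τ x₀ t h)

/-- The expected progress of one iteration towards a point `z` that may depend on the selections
made so far. The objective is evaluated at the intermediate point `y_t`. -/
lemma BlockProxSetting.integral_norm_step_le (hs : BlockProxSetting f g S τ L Lg μ J)
    (x₀ : BlockSpace N d) {t : ℕ} {z : (ℕ → Fin N → Fin m) → BlockSpace N d}
    (hz : DependsOn z (Finset.range t : Set ℕ)) :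
    ∫ ω, ‖blockProxIter f g S τ x₀ (fun s => J s ω) (t + 1) - z (fun s => J s ω)‖ ^ 2 ∂μ
      ≤ ∫ ω, ‖blockProxIter f g S τ x₀ (fun s => J s ω) t - z (fun s => J s ω)‖ ^ 2 ∂μ
        - 2 * τ * (∫ ω, blockObjective f g
              (blockGradStep f τ (blockProxIter f g S τ x₀ (fun s => J s ω) t)) ∂μ
            - ∫ ω, blockObjective f g (z (fun s => J s ω)) ∂μ)
        + τ ^ 2 * (m ^ 2 * Lg) ^ 2 := by
  set X : (ℕ → Fin N → Fin m) → BlockSpace N d := fun w => blockProxIter f g S τ x₀ w t with hXdef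
  have hX : DependsOn X (Finset.range t : Set ℕ) := dependsOn_blockProxIter f g S τ x₀ t
  set P : Fin m → BlockSpace N d → BlockSpace N d :=
    fun j x => prox (fun z => (m : ℝ) * τ * g j z) (blockGradStep f τ x) with hP
  have hint : ∀ F : BlockSpace N d → BlockSpace N d → ℝ,
      Integrable (fun ω => F (X (fun s => J s ω)) (z (fun s => J s ω))) μ := fun F =>
    integrable_of_dependsOn_range hs.measurable_J (Φ := fun w => F (X w) (z w)) (t := t)
      fun w w' h => by simp only [hX h, hz h]
  have hintJ : ∀ i, Integrable
      (fun ω => ‖P (J t ω i) (X (fun s => J s ω)) i - z (fun s => J s ω) i‖ ^ 2) μ := fun i =>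
    integrable_of_dependsOn_range hs.measurable_J
      (Φ := fun w => ‖P (w t i) (X w) i - z w i‖ ^ 2) (t := t + 1) fun w w' h => by
        have h' : ∀ s ∈ (Finset.range t : Set ℕ), w s = w' s := fun s hs =>
          h s (by simp at hs ⊢; omega)
        simp only [hX h', hz h', h t (by simp)]
  calc ∫ ω, ‖blockProxIter f g S τ x₀ (fun s => J s ω) (t + 1) - z (fun s => J s ω)‖ ^ 2 ∂μ
      = ∫ ω, ∑ i, ‖P (J t ω i) (X (fun s => J s ω)) i - z (fun s => J s ω) i‖ ^ 2 ∂μ := by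
        refine integral_congr_ae (Filter.Eventually.of_forall fun ω => ?_)
        simp only [PiLp.norm_sq_eq_of_L2, blockProxIter, PiLp.sub_apply]
        refine Finset.sum_congr rfl fun i _ => ?_
        rw [blockProxStep_apply hs.step_pos.le hs.convex_g hs.lipschitz_g
          hs.dependsOnlyOnBlocks_g]
    _ = ∑ i, ∫ ω, ‖P (J t ω i) (X (fun s => J s ω)) i - z (fun s => J s ω) i‖ ^ 2 ∂μ :=
        integral_finsetSum _ fun i _ => hintJ i
    _ = ∑ i, ∫ ω, (m : ℝ)⁻¹ * ∑ j, ‖P j (X (fun s => J s ω)) i - z (fun s => J s ω) i‖ ^ 2 ∂μ :=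
        Finset.sum_congr rfl fun i _ =>
          integral_uniform_selection hs.measurable_J hs.indep_J (π := fun v => v i)
            (fun j => hs.uniform_J t i j) (Φ := fun w j => ‖P j (X w) i - z w i‖ ^ 2)
            fun j w w' h => by simp only [hX h, hz h]
    _ = ∫ ω, ∑ i, (m : ℝ)⁻¹ * ∑ j, ‖P j (X (fun s => J s ω)) i - z (fun s => J s ω) i‖ ^ 2 ∂μ :=
        (integral_finsetSum _ fun i _ =>
          hint fun x z => (m : ℝ)⁻¹ * ∑ j, ‖P j x i - z i‖ ^ 2).symm
    _ ≤ ∫ ω, (‖X (fun s => J s ω) - z (fun s => J s ω)‖ ^ 2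
          - 2 * τ * (blockObjective f g (blockGradStep f τ (X (fun s => J s ω)))
            - blockObjective f g (z (fun s => J s ω))) + τ ^ 2 * (m ^ 2 * Lg) ^ 2) ∂μ := by
        refine integral_mono
          (hint fun x z => ∑ i, (m : ℝ)⁻¹ * ∑ j, ‖P j x i - z i‖ ^ 2)
          (hint fun x z => ‖x - z‖ ^ 2 - 2 * τ * (blockObjective f g (blockGradStep f τ x)
            - blockObjective f g z) + τ ^ 2 * (m ^ 2 * Lg) ^ 2) fun ω => ?_
        have h := average_norm_prox_sub_sq_le hs.convex_f hs.differentiable_f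
          hs.lipschitz_gradient hs.convex_g hs.lipschitz_g hs.one_le_m hs.step_pos.le hs.step_le
          (X (fun s => J s ω)) (z (fun s => J s ω))
        refine le_trans (le_of_eq ?_) h
        simp only [PiLp.norm_sq_eq_of_L2]
        rw [← Finset.mul_sum, Finset.sum_comm]
        rfl
    _ = _ := by
        rw [integral_add (hint fun x z => ‖x - z‖ ^ 2 - 2 * τ *
            (blockObjective f g (blockGradStep f τ x) - blockObjective f g z))
            (integrable_const _),
          integral_sub (hint fun x z => ‖x - z‖ ^ 2) (hint fun x z => 2 * τ *
            (blockObjective f g (blockGradStep f τ x) - blockObjective f g z)),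
          integral_const_mul, integral_sub (hint fun x z => blockObjective f g (blockGradStep f τ x))
            (hint fun x z => blockObjective f g z)]
        simp [hXdef]

lemma BlockProxSetting.sum_integral_objective_sub_le (hs : BlockProxSetting f g S τ L Lg μ J)
    (x₀ : BlockSpace N d) {s : ℕ} {z : (ℕ → Fin N → Fin m) → BlockSpace N d}
    (hz : DependsOn z (Finset.range s : Set ℕ)) (k : ℕ) :
    2 * τ * ∑ i ∈ Finset.range k, (∫ ω, blockObjective f g
          (blockGradStep f τ (blockProxIter f g S τ x₀ (fun t => J t ω) (s + i))) ∂μ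
        - ∫ ω, blockObjective f g (z (fun t => J t ω)) ∂μ)
      + ∫ ω, ‖blockProxIter f g S τ x₀ (fun t => J t ω) (s + k) - z (fun t => J t ω)‖ ^ 2 ∂μ
      ≤ ∫ ω, ‖blockProxIter f g S τ x₀ (fun t => J t ω) s - z (fun t => J t ω)‖ ^ 2 ∂μ
        + k * (τ ^ 2 * (m ^ 2 * Lg) ^ 2) := by
  induction k with
  | zero => simp
  | succ k ih =>
    have h := hs.integral_norm_step_le x₀ (t := s + k)
      (hz.mono (by simp))
    rw [Finset.sum_range_succ, ← add_assoc s k 1]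
    push_cast
    linarith

/-- The points `y_t` nearly improve on each of their predecessors on average: `x_{s+1}` is within
`τ m² L_g` of `y_s`, so that the iteration started there can be compared with `z = y_s`. -/
lemma BlockProxSetting.sum_integral_sub_le (hs : BlockProxSetting f g S τ L Lg μ J)
    (x₀ : BlockSpace N d) (s k : ℕ) :
    ∑ i ∈ Finset.range k, (∫ ω, blockObjective f g
          (blockGradStep f τ (blockProxIter f g S τ x₀ (fun t => J t ω) (s + 1 + i))) ∂μ
        - ∫ ω, blockObjective f g
          (blockGradStep f τ (blockProxIter f g S τ x₀ (fun t => J t ω) s)) ∂μ)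
      ≤ (k + 1) * (τ * (m ^ 2 * Lg) ^ 2 / 2) := by
  have h := hs.sum_integral_objective_sub_le x₀ (s := s + 1)
    ((dependsOn_blockGradStep_blockProxIter f g S τ x₀ s).mono
      (by simp)) k
  have h1 : ∫ ω, ‖blockProxIter f g S τ x₀ (fun t => J t ω) (s + 1)
      - blockGradStep f τ (blockProxIter f g S τ x₀ (fun t => J t ω) s)‖ ^ 2 ∂μ
      ≤ (τ * (m ^ 2 * Lg)) ^ 2 := by
    have := integral_mono_of_nonneg (μ := μ)
      (f := fun ω => ‖blockProxIter f g S τ x₀ (fun t => J t ω) (s + 1)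
        - blockGradStep f τ (blockProxIter f g S τ x₀ (fun t => J t ω) s)‖ ^ 2)
      (g := fun _ => (τ * (m ^ 2 * (Lg : ℝ))) ^ 2)
      (Filter.Eventually.of_forall fun ω => by positivity) (integrable_const _)
      (Filter.Eventually.of_forall fun ω => pow_le_pow_left₀ (norm_nonneg _)
        (norm_blockProxStep_sub_le hs.step_pos.le hs.convex_g hs.lipschitz_g
          hs.dependsOnlyOnBlocks_g hs.one_le_m (J s ω) _) 2)
    simpa using this
  have h2 : 0 ≤ ∫ ω, ‖blockProxIter f g S τ x₀ (fun t => J t ω) (s + 1 + k)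
      - blockGradStep f τ (blockProxIter f g S τ x₀ (fun t => J t ω) s)‖ ^ 2 ∂μ :=
    integral_nonneg fun ω => by positivity
  refine le_of_mul_le_mul_left ?_ (by linarith [hs.step_pos] : 0 < 2 * τ)
  calc _ ≤ _ := le_sub_iff_add_le.2 h
    _ ≤ _ := by nlinarith

variable {xs : BlockSpace N d}

lemma BlockProxSetting.integrable_comp_blockProxIter (hs : BlockProxSetting f g S τ L Lg μ J)
    (x₀ : BlockSpace N d) (F : BlockSpace N d → ℝ) (t : ℕ) :
    Integrable (fun ω => F (blockProxIter f g S τ x₀ (fun t => J t ω) t)) μ :=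
  integrable_of_dependsOn_range hs.measurable_J
    (Φ := fun w => F (blockProxIter f g S τ x₀ w t)) (t := t)
    fun _ _ h => congrArg F (dependsOn_blockProxIter f g S τ x₀ t h)

lemma BlockProxSetting.le_integral_objective (hs : BlockProxSetting f g S τ L Lg μ J)
    (x₀ : BlockSpace N d) (hxs : xs ∈ minimizers (blockObjective f g)) (t : ℕ) :
    blockObjective f g xs ≤ ∫ ω, blockObjective f g
      (blockGradStep f τ (blockProxIter f g S τ x₀ (fun t => J t ω) t)) ∂μ := by
  have := integral_mono (μ := μ) (integrable_const (blockObjective f g xs))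
    (hs.integrable_comp_blockProxIter x₀ (fun x => blockObjective f g (blockGradStep f τ x)) t)
    fun ω => hxs (Set.mem_univ _)
  simpa using this

/-- The rate at the last intermediate point `y_n`, against an arbitrary reference point. -/
lemma BlockProxSetting.integral_last_gradStep_le (hs : BlockProxSetting f g S τ L Lg μ J)
    (x₀ : BlockSpace N d) (xs : BlockSpace N d) (n : ℕ) :
    ∫ ω, blockObjective f g
        (blockGradStep f τ (blockProxIter f g S τ x₀ (fun t => J t ω) n)) ∂μ
      - blockObjective f g xs
      ≤ (‖x₀ - xs‖ ^ 2 / τ / (n + 1) + τ * (m ^ 2 * Lg) ^ 2) / 2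
        + τ * (m ^ 2 * Lg) ^ 2 * Real.log (n + 1) := by
  set a : ℕ → ℝ := fun t => ∫ ω, blockObjective f g
    (blockGradStep f τ (blockProxIter f g S τ x₀ (fun t => J t ω) t)) ∂μ
      - blockObjective f g xs with ha
  have hτ := hs.step_pos
  have h := last_le_average_add_log (a := a) (n := n) (B := τ * (m ^ 2 * Lg) ^ 2 / 2)
    (by positivity) (fun k hk hkn => by
      have h1 := hs.sum_integral_sub_le x₀ (n - k) k
      have hc : (k : ℝ) * a (n - k) = ∑ _i ∈ Finset.range k, a (n - k) := by simp
      rw [← Finset.sum_range_reflect, hc, ← Finset.sum_sub_distrib]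
      refine le_trans (le_of_eq (Finset.sum_congr rfl fun i hi => ?_)) h1
      have hi' := Finset.mem_range.1 hi
      rw [show n - (k - 1 - i) = n - k + 1 + i by omega]
      simp only [ha]
      ring) n le_rfl
  have h2 := hs.sum_integral_objective_sub_le x₀ (s := 0) (z := fun _ => xs)
    (fun _ _ _ => rfl) (n + 1)
  have h3 : 0 ≤ ∫ ω, ‖blockProxIter f g S τ x₀ (fun t => J t ω) (0 + (n + 1)) - xs‖ ^ 2 ∂μ :=
    integral_nonneg fun ω => by positivity
  simp only [integral_const, probReal_univ, smul_eq_mul, one_mul, zero_add, blockProxIter] at h2 h3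
  have h4 : ∑ i ∈ Finset.range (n + 1), a (n - i) = ∑ i ∈ Finset.range (n + 1), a i :=
    Finset.sum_range_reflect a (n + 1)
  have h5 : (∑ i ∈ Finset.range (n + 1), a (n - i)) / (n + 1)
      ≤ (‖x₀ - xs‖ ^ 2 / τ / (n + 1) + τ * (m ^ 2 * Lg) ^ 2) / 2 := by
    rw [h4, div_le_iff₀ (by positivity)]
    refine le_of_mul_le_mul_left ?_ (by linarith : 0 < 2 * τ)
    push_cast at h2
    calc _ ≤ ‖x₀ - xs‖ ^ 2 + (n + 1) * (τ ^ 2 * (m ^ 2 * Lg) ^ 2) := by linarith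
      _ = _ := by field_simp
  linarith

/-- The iterates stay at a bounded expected distance from the minimizer; this replaces a bound on
the gradients. -/
lemma BlockProxSetting.integral_norm_sub_sq_le (hs : BlockProxSetting f g S τ L Lg μ J)
    (x₀ : BlockSpace N d) (hxs : xs ∈ minimizers (blockObjective f g)) (T : ℕ) :
    ∫ ω, ‖blockProxIter f g S τ x₀ (fun t => J t ω) T - xs‖ ^ 2 ∂μ
      ≤ ‖x₀ - xs‖ ^ 2 + T * (τ ^ 2 * (m ^ 2 * Lg) ^ 2) := by
  have h2 := hs.sum_integral_objective_sub_le x₀ (s := 0) (z := fun _ => xs)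
    (fun _ _ _ => rfl) T
  simp only [integral_const, probReal_univ, smul_eq_mul, one_mul, zero_add, blockProxIter] at h2
  have h3 := Finset.sum_nonneg (s := Finset.range T) fun i _ =>
    sub_nonneg.2 (hs.le_integral_objective x₀ hxs i)
  have := mul_nonneg (by linarith [hs.step_pos] : 0 ≤ 2 * τ) h3
  linarith

/-- Passing from the intermediate point `y_n` to the iterate `x_{n+1}`. -/
lemma BlockProxSetting.integral_objective_sub_gradStep_le
    (hs : BlockProxSetting f g S τ L Lg μ J) (x₀ : BlockSpace N d)
    (hxs : xs ∈ minimizers (blockObjective f g)) (n : ℕ) :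
    ∫ ω, blockObjective f g (blockProxIter f g S τ x₀ (fun t => J t ω) (n + 1)) ∂μ
      - ∫ ω, blockObjective f g
        (blockGradStep f τ (blockProxIter f g S τ x₀ (fun t => J t ω) n)) ∂μ
      ≤ (2 * (m * Lg) + L * (1 + (‖x₀ - xs‖ ^ 2 + (n + 1) * (τ ^ 2 * (m ^ 2 * Lg) ^ 2))) / 2)
        * (τ * (m ^ 2 * Lg)) := by
  have hτ := hs.step_pos
  have hM : 0 ≤ τ * ((m : ℝ) ^ 2 * Lg) := by positivity
  have hsq := hs.integrable_comp_blockProxIter x₀ (fun x => ‖x - xs‖ ^ 2) (n + 1)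
  have h1 := integral_mono (μ := μ)
    ((hs.integrable_comp_blockProxIter x₀ (blockObjective f g) (n + 1)).sub
      (hs.integrable_comp_blockProxIter x₀ (fun x => blockObjective f g (blockGradStep f τ x)) n))
    (g := fun ω => (2 * (m * Lg) + L / 2 + L / 2 *
      ‖blockProxIter f g S τ x₀ (fun t => J t ω) (n + 1) - xs‖ ^ 2) * (τ * (m ^ 2 * Lg)))
    (((integrable_const _).add (hsq.const_mul _)).mul_const _) fun ω => by
      set x := blockProxIter f g S τ x₀ (fun t => J t ω) n
      set x' := blockProxIter f g S τ x₀ (fun t => J t ω) (n + 1) with hx'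
      have h2 := blockObjective_sub_le hs.convex_f hs.differentiable_f hs.lipschitz_gradient
        hs.lipschitz_g hxs x' (blockGradStep f τ x)
      have h3 : ‖x' - blockGradStep f τ x‖ ≤ τ * (m ^ 2 * Lg) :=
        norm_blockProxStep_sub_le hs.step_pos.le hs.convex_g hs.lipschitz_g
          hs.dependsOnlyOnBlocks_g hs.one_le_m (J n ω) x
      refine h2.trans (mul_le_mul ?_ h3 (norm_nonneg _) (by positivity))
      have hL : (0 : ℝ) ≤ L := L.2
      nlinarith [mul_nonneg hL (sq_nonneg (‖x' - xs‖ - 1))]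
  simp only [Pi.sub_apply] at h1
  rw [integral_sub (hs.integrable_comp_blockProxIter x₀ (blockObjective f g) (n + 1))
      (hs.integrable_comp_blockProxIter x₀ (fun x => blockObjective f g (blockGradStep f τ x)) n),
    integral_mul_const, integral_add (integrable_const _) (hsq.const_mul _),
    integral_const_mul] at h1
  simp only [integral_const, probReal_univ, smul_eq_mul, one_mul] at h1
  refine h1.trans (mul_le_mul_of_nonneg_right ?_ hM)
  have h4 := hs.integral_norm_sub_sq_le x₀ hxs (n + 1)
  push_cast at h4
  have hL : (0 : ℝ) ≤ L / 2 := by positivity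
  nlinarith [mul_le_mul_of_nonneg_left h4 hL]

end Iteration

/-! ### The rate for the step size `1 / (3 L √T)` -/

/-- The bound on `E h(y_{T-1}) - h*` (here `e₁`) and on `E h(x_T) - E h(y_{T-1})` (here `e₂`), for
the step size `τ = r / √T`. The squared initial distance is `R`, with an upper bound `R'`. -/
lemma rate_of_step_size {r M c l R T τ e₁ e₂ : ℝ} (hr : 0 < r) (hM : 0 ≤ M) (hT : 1 ≤ T)
    (hτ : τ = r / √T)
    (h₁ : e₁ ≤ (R / τ / T + τ * M ^ 2) / 2 + τ * M ^ 2 * Real.log T)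
    (h₂ : e₂ ≤ (2 * c + l * (1 + (R + T * (τ ^ 2 * M ^ 2))) / 2) * (τ * M))
    {R' : ℝ} (hR : R ≤ R') (hR' : 0 ≤ R') (hl : 0 ≤ l) (hc : 0 ≤ c) :
    e₁ + e₂ ≤ (R' / r + r * M ^ 2
        + 2 * ((2 * c + l * (1 + (R' + r ^ 2 * M ^ 2)) / 2) * (r * M)) + r * M ^ 2)
      * (Real.log (T + 1) / √T) := by
  have hT0 : 0 < T := by linarith
  have hs : 0 < √T := Real.sqrt_pos.2 hT0
  have hss : √T ^ 2 = T := Real.sq_sqrt hT0.le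
  have hlog : Real.log T ≤ Real.log (T + 1) := Real.log_le_log hT0 (by linarith)
  -- `log (T + 1) ≥ log 2 ≥ 1 / 2` absorbs the terms without a logarithm.
  have hlog1 : 1 ≤ 2 * Real.log (T + 1) := by
    have h2 := Real.log_two_gt_d9
    have := Real.log_le_log (by norm_num : (0 : ℝ) < 2) (by linarith : 2 ≤ T + 1)
    linarith
  have e1 : R / τ / T = R / r / √T := by
    rw [hτ]
    field_simp
    rw [hss]
  have e2 : T * (τ ^ 2 * M ^ 2) = r ^ 2 * M ^ 2 := by
    rw [hτ, div_pow, hss]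
    field_simp
  set A := (R' / r + r * M ^ 2) / 2
    + (2 * c + l * (1 + (R' + r ^ 2 * M ^ 2)) / 2) * (r * M) with hA
  have hA0 : 0 ≤ A := by positivity
  have h3 : e₁ + e₂ ≤ (A + r * M ^ 2 * Real.log T) / √T := by
    rw [e1] at h₁
    rw [e2] at h₂
    have h4 : R / r ≤ R' / r := by gcongr
    have h5 : (2 * c + l * (1 + (R + r ^ 2 * M ^ 2)) / 2) * (r * M)
        ≤ (2 * c + l * (1 + (R' + r ^ 2 * M ^ 2)) / 2) * (r * M) := by gcongr
    calc e₁ + e₂ ≤ ((R / r + r * M ^ 2) / 2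
          + (2 * c + l * (1 + (R + r ^ 2 * M ^ 2)) / 2) * (r * M)
          + r * M ^ 2 * Real.log T) / √T := by
          refine (add_le_add h₁ h₂).trans (le_of_eq ?_)
          rw [hτ]
          ring
      _ ≤ _ := by
          gcongr
          linarith
  refine h3.trans ?_
  rw [← mul_div_assoc]
  gcongr
  have h6 : 0 ≤ r * M ^ 2 := by positivity
  nlinarith [mul_le_mul_of_nonneg_left hlog1 hA0, mul_le_mul_of_nonneg_left hlog h6]

theorem mainTheorem3 (m : ℕ) (L Lg : ℝ≥0) (hL : 0 < L) (D : ℝ) :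
    ∃ C : ℝ, ∀ (N d : ℕ)
      (f : Fin N → EuclideanSpace ℝ (Fin d) → ℝ)
      (g : Fin m → BlockSpace N d → ℝ)
      (S : Fin m → Finset (Fin N))
      (x₀ : BlockSpace N d)
      (Ω : Type*) [MeasurableSpace Ω] (μ : Measure Ω) [IsProbabilityMeasure μ]
      (J : ℕ → Ω → Fin N → Fin m),
      (∀ i, ConvexOn ℝ Set.univ (f i)) →
      (∀ i, Differentiable ℝ (f i)) →
      (∀ i, LipschitzWith L (gradient (f i))) →
      (∀ j, ConvexOn ℝ Set.univ (g j)) →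
      (∀ j, LipschitzWith Lg (g j)) →
      (∀ j, DependsOnlyOnBlocks (g j) (S j)) →
      (minimizers (blockObjective f g)).Nonempty →
      Metric.infDist x₀ (minimizers (blockObjective f g)) ≤ D →
      (∀ t, Measurable (J t)) →
      (∀ t i j, μ {ω | J t ω i = j} = (m : ℝ≥0∞)⁻¹) →
      iIndepFun J μ →
      ∀ T : ℕ, 1 ≤ T → ∀ τ : ℝ, τ = 1 / (3 * (L : ℝ) * Real.sqrt (T : ℝ)) →
        Integrable (fun ω =>
          blockObjective f g (blockProxIter f g S τ x₀ (fun t => J t ω) T)) μ ∧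
        ∫ ω, (blockObjective f g (blockProxIter f g S τ x₀ (fun t => J t ω) T)
            - ⨅ x, blockObjective f g x) ∂μ
          ≤ C * (Real.log ((T : ℝ) + 1) / Real.sqrt (T : ℝ)) := by
  refine ⟨(D + 1) ^ 2 / (1 / (3 * L)) + 1 / (3 * L) * (m ^ 2 * Lg) ^ 2
    + 2 * ((2 * (m * Lg) + L * (1 + ((D + 1) ^ 2 + (1 / (3 * L)) ^ 2 * (m ^ 2 * Lg) ^ 2)) / 2)
      * (1 / (3 * L) * (m ^ 2 * Lg))) + 1 / (3 * L) * (m ^ 2 * Lg) ^ 2, ?_⟩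
  intro N d f g S x₀ Ω _ μ _ J hfc hfd hfL hgc hg hS hne hD hJ hunif hind T hT τ hτ
  have hint : Integrable (fun ω =>
      blockObjective f g (blockProxIter f g S τ x₀ (fun t => J t ω) T)) μ :=
    integrable_of_dependsOn_range hJ
      (Φ := fun w => blockObjective f g (blockProxIter f g S τ x₀ w T)) (t := T)
      fun _ _ h => congrArg _ (dependsOn_blockProxIter f g S τ x₀ T h)
  refine ⟨hint, ?_⟩
  have hL' : (0 : ℝ) < L := hL
  have hT' : (1 : ℝ) ≤ T := by exact_mod_cast hT
  obtain ⟨xs, hxs, hdist⟩ := (Metric.infDist_lt_iff hne).1 (hD.trans_lt (lt_add_one D))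
  have hinf : ⨅ x, blockObjective f g x = blockObjective f g xs :=
    le_antisymm (ciInf_le ⟨_, Set.forall_mem_range.2 fun x => hxs (Set.mem_univ x)⟩ xs)
      (le_ciInf fun x => hxs (Set.mem_univ x))
  rw [hinf]
  rcases Nat.eq_zero_or_pos m with rfl | hm
  · -- Without any `g_j` a node has nothing to select, so there are no nodes and `x_T = xs`.
    obtain ⟨ω₀⟩ : Nonempty Ω := nonempty_of_isProbabilityMeasure μ
    have hN : IsEmpty (Fin N) := ⟨fun i => (J 0 ω₀ i).elim0⟩
    have heq : ∀ x : BlockSpace N d, x = xs := fun x => by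
      ext i
      exact hN.elim i
    have hzero : ∀ ω, blockObjective f g (blockProxIter f g S τ x₀ (fun t => J t ω) T)
        - blockObjective f g xs = 0 := fun ω => by
      rw [heq (blockProxIter f g S τ x₀ (fun t => J t ω) T), sub_self]
    simp only [hzero, integral_zero]
    have : 0 ≤ Real.log ((T : ℝ) + 1) := Real.log_nonneg (by linarith)
    positivity
  · obtain ⟨n, rfl⟩ : ∃ n, T = n + 1 := ⟨T - 1, by omega⟩
    have hsq : 1 ≤ √((n + 1 : ℕ) : ℝ) := Real.one_le_sqrt.2 hT'
    have hτ' : τ = 1 / (3 * (L : ℝ)) / √((n + 1 : ℕ) : ℝ) := by rw [hτ, div_div]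
    have hs : BlockProxSetting f g S τ L Lg μ J :=
      { convex_f := hfc
        differentiable_f := hfd
        lipschitz_gradient := hfL
        convex_g := hgc
        lipschitz_g := hg
        dependsOnlyOnBlocks_g := hS
        one_le_m := hm
        step_pos := by rw [hτ]; positivity
        step_le := by
          rw [hτ, mul_one_div, div_le_iff₀ (by positivity)]
          nlinarith
        measurable_J := hJ
        uniform_J := hunif
        indep_J := hind }
    have h1 := hs.integral_last_gradStep_le x₀ xs n
    have h2 := hs.integral_objective_sub_gradStep_le x₀ hxs n
    rw [integral_sub hint (integrable_const _)]
    simp only [integral_const, probReal_univ, smul_eq_mul, one_mul]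
    have hR : ‖x₀ - xs‖ ^ 2 ≤ (D + 1) ^ 2 := by
      rw [← dist_eq_norm]
      exact pow_le_pow_left₀ dist_nonneg hdist.le 2
    rw [← Nat.cast_succ] at h1 h2
    have h3 := rate_of_step_size (by positivity : 0 < 1 / (3 * (L : ℝ)))
      (by positivity : 0 ≤ (m : ℝ) ^ 2 * Lg) hT' hτ' h1 h2 hR (by positivity) L.2
      (by positivity : 0 ≤ (m : ℝ) * Lg)
    linarith
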